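/- Let $n$ be a natural number. For a real $n\times n$ matrix $A$, let $\mathrm{Spec}(A)\subset\mathbb{C}$ be the set of complex eigenvalues of $A$, and let $R(A)$ be the set of nonzero $\lambda\in\mathrm{Spec}(A)$ whose argument is a rational multiple of $2\pi$ (equivalently, $\lambda^k>0$ for some integer $k\ge 1$). Say that - $A$ satisfies Assumption $(\mathcal{G})$ if for every $\lambda\in R(A)$ and every nonzero $\mu\in\mathrm{Spec}(A)$ with $|\mu|=|\lambda|$, one has $\mu=\zeta\lambda$ for some root of unity $\zeta\in\mathbb{C}$ (equivalently, $\mu\in R(A)$); - $A$ satisfies Assumption $(\mathcal{A})$ if it satisfies Assumption $(\mathcal{G})$ and no element of $\mathrm{Spec}(A)\setminus R(A)$ has modulus $1$. Theorem. The set of matrices in $\mathcal{M}(n,\mathbb{R})$ satisfying Assumption $(\mathcal{G})$ contains a dense open subset of $\mathcal{M}(n,\mathbb{R})\cong\mathbb{R}^{n^2}$ of full Lebesgue measure, i.e. whose complement has Lebesgue measure zero. The set of matrices in $\mathcal{M}(n,\mathbb{R})$ satisfying Assumption $(\mathcal{A})$ likewise contains a dense open subset of $\mathcal{M}(n,\mathbb{R})$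 whose complement has Lebesgue measure zero. -/

import Mathlib

open MeasureTheory

/-- The set of complex eigenvalues of a real square matrix. -/
def complexSpec {n : ℕ} (A : Matrix (Fin n) (Fin n) ℝ) : Set ℂ :=
  {z | Module.End.HasEigenvalue (Matrix.toLin' (A.map (fun x : ℝ => (x : ℂ)))) z}

/-- The set `R(A)` of nonzero complex eigenvalues of `A` whose argument is a rational multiple
of `2π`. -/
def rationalArgSpec {n : ℕ} (A : Matrix (Fin n) (Fin n) ℝ) : Set ℂ :=
  {z | z ∈ complexSpec A ∧ z ≠ 0 ∧ ∃ q : ℚ, Complex.arg z = 2 * Real.pi * (q : ℝ)}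

/-- Assumption (G): every nonzero eigenvalue with the same modulus as an eigenvalue `z ∈ R(A)`
is equal to `z` up to a root of unity. -/
def AssumptionG {n : ℕ} (A : Matrix (Fin n) (Fin n) ℝ) : Prop :=
  ∀ z ∈ rationalArgSpec A, ∀ w ∈ complexSpec A, w ≠ 0 → ‖w‖ = ‖z‖ →
    ∃ ζ : ℂ, (∃ k : ℕ, 0 < k ∧ ζ ^ k = 1) ∧ w = ζ * z

/-- Assumption (A): assumption (G) holds and every eigenvalue of modulus `1` lies in `R(A)`. -/
def AssumptionA {n : ℕ} (A : Matrix (Fin n) (Fin n) ℝ) : Prop :=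
  AssumptionG A ∧ ∀ z ∈ complexSpec A \ rationalArgSpec A, ‖z‖ ≠ 1

/-- The set `S` of real `n × n` matrices contains a dense open subset whose complement is null for
Lebesgue measure (the product measure on the `n * n` entries). -/
def ContainsDenseOpenFullMeasure {n : ℕ} (S : Set (Matrix (Fin n) (Fin n) ℝ)) : Prop :=
  ∃ V : Set (Matrix (Fin n) (Fin n) ℝ), V ⊆ S ∧ IsOpen V ∧ Dense V ∧
    (volume : Measure (Fin n → Fin n → ℝ)) {f | Matrix.of f ∉ V} = 0

/-!
A real matrix whose characteristic polynomial has complex roots `μ₁, …, μₙ` satisfies both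
assumptions as soon as the pairwise products `μᵢ μⱼ`, indexed by unordered pairs, are distinct from
one another and from `1`. The reason is that the roots are stable under complex conjugation, so the
squared modulus `z * conj z` of an eigenvalue is one of these products. If two eigenvalues `z`, `w`
have the same modulus, then `{w, conj w} = {z, conj z}`, and `conj z / z` is a root of unity when
the argument of `z` is a rational multiple of `2π`; and no eigenvalue has modulus `1`.

The condition on the products is the non-vanishing of `sepPoly`, a symmetric polynomial in the
roots. By the fundamental theorem on symmetric polynomials and Vieta's formulas
(`exists_mvPolynomial_eval_eq_aeval_roots`) it is a polynomial in the entries of the matrix. That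
polynomial is not identically zero: `sepPoly` is a nonzero polynomial, hence nonzero at some real
point, and a diagonal matrix has that point as its roots. Its zero set is closed, and it is
Lebesgue null because a line through a point outside the zero set meets it finitely often
(`addHaar_zeros_eq_zero_of_finite_on_lines`).
-/

open MvPolynomial ComplexConjugate

/-! ### Zero sets of polynomial functions are null -/

/-- If every line through `x₀` meets the zero set of a continuous function in finitely many points,
then this zero set is null for additive Haar measure. By Fubini, almost every homothety centred at
`x₀` pulls the zero set back to a null set, and homotheties scale the measure. -/
theorem addHaar_zeros_eq_zero_of_finite_on_lines {E : Type*} [NormedAddCommGroup E]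
    [NormedSpace ℝ E] [FiniteDimensional ℝ E] [MeasurableSpace E] [BorelSpace E]
    (μ : Measure E) [μ.IsAddHaarMeasure] {f : E → ℝ} (hf : Continuous f) (x₀ : E)
    (hfin : ∀ v : E, {t : ℝ | f (x₀ + t • v) = 0}.Finite) :
    μ {x | f x = 0} = 0 := by
  have hmeas : MeasurableSet {p : E × ℝ | f (x₀ + p.2 • p.1) = 0} :=
    (isClosed_eq (by fun_prop) continuous_const).measurableSet
  have hprod : (μ.prod volume) {p : E × ℝ | f (x₀ + p.2 • p.1) = 0} = 0 :=
    (Measure.measure_prod_null hmeas).2 (.of_forall fun v => (hfin v).measure_zero _)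
  have hswap : ((volume : Measure ℝ).prod μ) {p : ℝ × E | f (x₀ + p.1 • p.2) = 0} = 0 := by
    rw [← Measure.prod_swap, Measure.map_apply measurable_swap
      (isClosed_eq (by fun_prop) continuous_const).measurableSet]
    exact hprod
  have hne : ∀ᵐ t : ℝ, t ≠ 0 := by simp [ae_iff]
  obtain ⟨t, ht, ht0⟩ := ((Measure.measure_ae_null_of_prod_null hswap).and hne).exists
  have ht' : μ ((t • ·) ⁻¹' ((x₀ + ·) ⁻¹' {x | f x = 0})) = 0 := ht
  rw [Measure.addHaar_preimage_smul μ ht0, measure_preimage_add] at ht'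
  refine (mul_eq_zero.1 ht').resolve_left ?_
  exact (ENNReal.ofReal_pos.2 (abs_pos.2 (inv_ne_zero (pow_ne_zero _ ht0)))).ne'

theorem MvPolynomial.finite_setOf_eval_add_smul_eq_zero {σ : Type*} (P : MvPolynomial σ ℝ)
    {x₀ : σ → ℝ} (h₀ : eval x₀ P ≠ 0) (v : σ → ℝ) :
    {t : ℝ | eval (fun i => x₀ i + t * v i) P = 0}.Finite := by
  let q : Polynomial ℝ := aeval (fun i => Polynomial.C (x₀ i) + Polynomial.X * Polynomial.C (v i)) P
  have hq (t : ℝ) : q.eval t = eval (fun i => x₀ i + t * v i) P := by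
    rw [← Polynomial.coe_aeval_eq_eval, ← MvPolynomial.coe_aeval_eq_eval]
    change ((Polynomial.aeval t).comp (aeval _)) P = _
    rw [MvPolynomial.comp_aeval]
    simp only [map_add, map_mul, Polynomial.aeval_C, Polynomial.aeval_X,
      Algebra.algebraMap_self_apply]
    rfl
  have hq0 : q ≠ 0 := by
    intro h
    apply h₀
    simpa [h] using (hq 0).symm
  refine (q.roots.toFinset.finite_toSet).subset fun t ht => ?_
  simp only [Finset.mem_coe, Multiset.mem_toFinset, Polynomial.mem_roots hq0, Polynomial.IsRoot, hq]
  exact ht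

/-- A set of real matrices containing the non-vanishing locus of a polynomial in the entries which
is not identically zero contains a dense open set of full measure. -/
theorem containsDenseOpenFullMeasure_of_eval_ne_zero {n : ℕ} {S : Set (Matrix (Fin n) (Fin n) ℝ)}
    (P : MvPolynomial (Fin n × Fin n) ℝ) (A₀ : Matrix (Fin n) (Fin n) ℝ)
    (h₀ : eval (fun p => A₀ p.1 p.2) P ≠ 0)
    (hS : ∀ A : Matrix (Fin n) (Fin n) ℝ, eval (fun p => A p.1 p.2) P ≠ 0 → A ∈ S) :
    ContainsDenseOpenFullMeasure S := by
  have hcont : Continuous fun f : Fin n → Fin n → ℝ => eval (fun p => f p.1 p.2) P :=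
    (MvPolynomial.continuous_eval P).comp (by fun_prop)
  have hnull : (volume : Measure (Fin n → Fin n → ℝ)) {f | eval (fun p => f p.1 p.2) P = 0} = 0 :=
    addHaar_zeros_eq_zero_of_finite_on_lines volume hcont A₀ fun v =>
      P.finite_setOf_eval_add_smul_eq_zero h₀ fun p => v p.1 p.2
  refine ⟨{A | eval (fun p => A p.1 p.2) P ≠ 0}, hS, ?_, ?_, ?_⟩
  · exact isOpen_ne_fun hcont continuous_const
  · exact Measure.dense_of_ae (μ := (volume : Measure (Fin n → Fin n → ℝ)))
      (p := fun f => eval (fun p => f p.1 p.2) P ≠ 0) (by simpa [ae_iff] using hnull)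
  · simpa using hnull

/-! ### Symmetric polynomials in the roots of the characteristic polynomial -/

/-- A symmetric polynomial in the roots of the characteristic polynomial is a polynomial in the
entries of the matrix. -/
theorem exists_mvPolynomial_eval_eq_aeval_roots {R S : Type*} [CommRing R] [CommRing S]
    [Algebra R S] {n : ℕ} {Φ : MvPolynomial (Fin n) R} (hΦ : Φ.IsSymmetric) :
    ∃ P : MvPolynomial (Fin n × Fin n) R, ∀ (A : Matrix (Fin n) (Fin n) R) (r : Fin n → S),
      (A.map (algebraMap R S)).charpoly = ∏ i, (Polynomial.X - Polynomial.C (r i)) →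
      algebraMap R S (eval (fun p => A p.1 p.2) P) = aeval r Φ := by
  obtain ⟨Q, hQ⟩ := esymmAlgHom_surjective R (σ := Fin n) (n := n) (by simp) ⟨Φ, hΦ⟩
  have hQ' : aeval (fun i : Fin n => esymm (Fin n) R (i + 1)) Q = Φ := by
    rw [← esymmAlgHom_apply, hQ]
  -- By Vieta, `(-1) ^ k * coeff (n - k)` is the `k`-th elementary symmetric function of the roots.
  refine ⟨aeval (fun i : Fin n =>
    (-1) ^ (i + 1 : ℕ) * (Matrix.charpoly.univ R (Fin n)).coeff (n - (i + 1))) Q, fun A r hr => ?_⟩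
  have hcoeff (i : Fin n) : algebraMap R S (A.charpoly.coeff (n - (i + 1))) =
      (-1) ^ (i + 1 : ℕ) * aeval r (esymm (Fin n) R (i + 1)) := by
    have hcard : Multiset.card (Finset.univ.val.map r) = n := by simp
    have hi : n - (n - (i + 1 : ℕ)) = i + 1 := by omega
    have hv := Multiset.prod_X_sub_C_coeff (Finset.univ.val.map r) (k := n - (i + 1)) (by simp)
    rw [hcard, hi, ← aeval_esymm_eq_multiset_esymm (Fin n) R] at hv
    rw [← hv, ← Polynomial.coeff_map, ← Matrix.charpoly_map, hr,
      Multiset.map_map]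
    rfl
  have huniv (k : ℕ) : eval (fun p : Fin n × Fin n => A p.1 p.2)
      ((Matrix.charpoly.univ R (Fin n)).coeff k) = A.charpoly.coeff k :=
    Matrix.charpoly.univ_coeff_eval₂Hom (Fin n) (RingHom.id R) (fun p => A p.1 p.2) k
  rw [← hQ', ← MvPolynomial.coe_aeval_eq_eval]
  change ((Algebra.ofId R S).comp ((aeval _).comp (aeval _))) Q = ((aeval r).comp (aeval _)) Q
  rw [MvPolynomial.comp_aeval, MvPolynomial.comp_aeval, MvPolynomial.comp_aeval]
  congr 2
  funext i
  change algebraMap R S (eval _ ((-1) ^ (i + 1 : ℕ) * _)) = _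
  rw [map_mul, huniv, map_mul, map_pow, map_neg, map_one,
    map_pow, map_neg, map_one, hcoeff, ← mul_assoc, ← mul_pow]
  simp

theorem Matrix.exists_charpoly_eq_prod_X_sub_C {K : Type*} [Field K] [IsAlgClosed K] {n : ℕ}
    (B : Matrix (Fin n) (Fin n) K) :
    ∃ r : Fin n → K, B.charpoly = ∏ i, (Polynomial.X - Polynomial.C (r i)) := by
  have hs := IsAlgClosed.splits B.charpoly
  have hprod := hs.eq_prod_roots_of_monic B.charpoly_monic
  have hcard : Multiset.card B.charpoly.roots = n := by
    rw [← hs.natDegree_eq_card_roots, B.charpoly_natDegree_eq_dim, Fintype.card_fin]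
  generalize B.charpoly.roots = s at hprod hcard
  induction s using Quotient.inductionOn with
  | h l =>
    obtain rfl : l.length = n := hcard
    refine ⟨l.get, hprod.trans ?_⟩
    rw [← List.prod_ofFn]
    exact congrArg List.prod (by simp [List.ofFn_comp'])

/-! ### The separation polynomial -/

section SepPoly

variable (σ : Type*)

open Classical in
/-- The polynomial expressing that the products of unordered pairs of variables (with repetition)
are distinct from one another and from `1`. Every difference of two distinct products occurs with
both signs, which makes the polynomial symmetric. -/
noncomputable def sepPoly [Fintype σ] : MvPolynomial σ ℝ :=
  (∏ s : Sym2 σ, ∏ t : Sym2 σ, if s = t then 1 else (s.map X).mul - (t.map X).mul) *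
    ∏ s : Sym2 σ, ((s.map X).mul - 1)

variable {σ}

theorem sym2_mul_map_X_injective :
    Function.Injective fun s : Sym2 σ => (s.map (X : σ → MvPolynomial σ ℝ)).mul := by
  intro s t h
  induction s with
  | _ i j =>
  induction t with
  | _ k l =>
  simp only [Sym2.map_mk, Sym2.mul_mk] at h
  have hX (a : σ) : (X a : MvPolynomial σ ℝ) ≠ 0 := X_ne_zero a
  have hdvd : (X i : MvPolynomial σ ℝ) ∣ X k * X l := ⟨X j, h.symm⟩
  rcases (MvPolynomial.X_prime (i := i)).dvd_or_dvd hdvd with hd | hd <;>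
    rw [X_dvd_X] at hd <;> subst hd
  · rw [X_injective (mul_left_cancel₀ (hX i) h)]
  · rw [mul_comm (X k)] at h
    rw [X_injective (mul_left_cancel₀ (hX i) h), Sym2.eq_swap]

variable [Fintype σ]

theorem isSymmetric_sepPoly : (sepPoly σ).IsSymmetric := by
  classical
  intro e
  let e₂ : Sym2 σ ≃ Sym2 σ :=
    ⟨Sym2.map e, Sym2.map e.symm, fun s => by simp [Sym2.map_map], fun s => by simp [Sym2.map_map]⟩
  have hren (s : Sym2 σ) : rename e (s.map (X : σ → MvPolynomial σ ℝ)).mul =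
      ((e₂ s).map X).mul := by
    induction s with
    | _ a b => simp [e₂]
  simp only [sepPoly, map_mul, map_prod, map_sub, map_one, apply_ite, hren]
  congr 1
  · refine Fintype.prod_equiv e₂ _ _ fun s => Fintype.prod_equiv e₂ _ _ fun t => ?_
    simp
  · exact Fintype.prod_equiv e₂ _ _ fun s => rfl

theorem sepPoly_ne_zero : sepPoly σ ≠ 0 := by
  classical
  refine mul_ne_zero (Finset.prod_ne_zero_iff.2 fun s _ => Finset.prod_ne_zero_iff.2 fun t _ => ?_)
    (Finset.prod_ne_zero_iff.2 fun s _ => ?_)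
  · split_ifs with h
    · exact one_ne_zero
    · exact sub_ne_zero.2 fun h' => h (sym2_mul_map_X_injective h')
  · induction s with
    | _ i j =>
      intro h
      simpa using congrArg constantCoeff h

theorem aeval_sepPoly_ne_zero_iff {K : Type*} [Field K] [Algebra ℝ K] (r : σ → K) :
    aeval r (sepPoly σ) ≠ 0 ↔
      (Function.Injective fun s : Sym2 σ => (s.map r).mul) ∧ ∀ s : Sym2 σ, (s.map r).mul ≠ 1 := by
  classical
  have hev (s : Sym2 σ) : aeval r (s.map (X : σ → MvPolynomial σ ℝ)).mul = (s.map r).mul := by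
    induction s with
    | _ a b => simp
  simp only [sepPoly, map_mul, map_prod, map_sub, map_one, apply_ite (aeval r), hev, mul_ne_zero_iff,
    Finset.prod_ne_zero_iff, Finset.mem_univ, true_imp_iff, sub_ne_zero]
  refine and_congr_left fun _ => forall₂_congr fun s t => ?_
  split_ifs with h <;> simp [h, sub_ne_zero]

end SepPoly

/-! ### Eigenvalues of a matrix with separated products -/

theorem mem_complexSpec_iff_isRoot {n : ℕ} {A : Matrix (Fin n) (Fin n) ℝ} {z : ℂ} :
    z ∈ complexSpec A ↔ (A.map (algebraMap ℝ ℂ)).charpoly.IsRoot z := by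
  rw [← Matrix.charpoly_toLin', ← Module.End.hasEigenvalue_iff_isRoot_charpoly]
  rfl

theorem conj_mem_complexSpec {n : ℕ} {A : Matrix (Fin n) (Fin n) ℝ} {z : ℂ}
    (hz : z ∈ complexSpec A) : conj z ∈ complexSpec A := by
  rw [mem_complexSpec_iff_isRoot, Matrix.charpoly_map,
    Polynomial.IsRoot, Polynomial.eval_map_algebraMap] at hz ⊢
  rw [Polynomial.aeval_conj, hz, map_zero]

/-- If `arg z = 2π q`, then `z ^ q.den` is real, so `z` and `conj z` have the same power. -/
theorem conj_pow_den_eq_pow_den_of_arg {z : ℂ} {q : ℚ}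
    (hq : Complex.arg z = 2 * Real.pi * (q : ℝ)) : conj z ^ q.den = z ^ q.den := by
  have hz : z ^ q.den = ((‖z‖ ^ q.den : ℝ) : ℂ) := by
    conv_lhs => rw [← Complex.norm_mul_exp_arg_mul_I z, mul_pow, ← Complex.exp_nat_mul, hq]
    have : (q.den : ℂ) * (((2 * Real.pi * (q : ℝ) : ℝ) : ℂ) * Complex.I) =
        (q.num : ℂ) * (2 * Real.pi * Complex.I) := by
      have hqc : (q.den : ℂ) * (q : ℂ) = q.num := by exact_mod_cast Rat.den_mul_eq_num q
      push_cast
      rw [← hqc]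
      ring
    rw [this, Complex.exp_int_mul_two_pi_mul_I]
    simp
  rw [← map_pow, hz, Complex.conj_ofReal]

theorem assumptionA_of_separated {n : ℕ} {A : Matrix (Fin n) (Fin n) ℝ} {r : Fin n → ℂ}
    (hr : (A.map (algebraMap ℝ ℂ)).charpoly = ∏ i, (Polynomial.X - Polynomial.C (r i)))
    (hinj : Function.Injective fun s : Sym2 (Fin n) => (s.map r).mul)
    (hone : ∀ s : Sym2 (Fin n), (s.map r).mul ≠ 1) : AssumptionA A := by
  have hspec {z : ℂ} (hz : z ∈ complexSpec A) : ∃ i, r i = z := by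
    rw [mem_complexSpec_iff_isRoot, hr, Polynomial.IsRoot, Polynomial.eval_prod,
      Finset.prod_eq_zero_iff] at hz
    obtain ⟨i, -, hi⟩ := hz
    exact ⟨i, by simpa [sub_eq_zero, eq_comm] using hi⟩
  have hpair {z : ℂ} (hz : z ∈ complexSpec A) :
      ∃ s : Sym2 (Fin n), s.map r = s(z, conj z) ∧ (s.map r).mul = (‖z‖ : ℂ) ^ 2 := by
    obtain ⟨i, hi⟩ := hspec hz
    obtain ⟨j, hj⟩ := hspec (conj_mem_complexSpec hz)
    exact ⟨s(i, j), by simp [hi, hj], by simp [hi, hj, Complex.mul_conj']⟩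
  constructor
  · rintro z ⟨hz, hz0, q, hq⟩ w hw - hwz
    obtain ⟨s, hs, hs'⟩ := hpair hz
    obtain ⟨t, ht, ht'⟩ := hpair hw
    -- `w * conj w = ‖w‖ ^ 2 = ‖z‖ ^ 2 = z * conj z`, so both products come from the same pair.
    obtain rfl : s = t := hinj (by simp only [hs', ht', hwz])
    rcases Sym2.eq_iff.1 (ht.symm.trans hs) with ⟨rfl, -⟩ | ⟨rfl, -⟩
    · exact ⟨1, ⟨1, one_pos, by simp⟩, by simp⟩
    · refine ⟨conj z / z, ⟨q.den, q.den_pos, ?_⟩, by field_simp⟩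
      rw [div_pow, conj_pow_den_eq_pow_den_of_arg hq, div_self (pow_ne_zero _ hz0)]
  · rintro z ⟨hz, -⟩ hz1
    obtain ⟨s, -, hs⟩ := hpair hz
    exact hone s (by simp [hs, hz1])

theorem mainTheorem3 (n : ℕ) :
    ContainsDenseOpenFullMeasure {A : Matrix (Fin n) (Fin n) ℝ | AssumptionG A} ∧
      ContainsDenseOpenFullMeasure {A : Matrix (Fin n) (Fin n) ℝ | AssumptionA A} := by
  obtain ⟨P, hP⟩ := exists_mvPolynomial_eval_eq_aeval_roots (S := ℂ)
    (isSymmetric_sepPoly (σ := Fin n))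
  obtain ⟨d, hd⟩ : ∃ d : Fin n → ℝ, eval d (sepPoly (Fin n)) ≠ 0 := by
    by_contra! h
    exact sepPoly_ne_zero (MvPolynomial.funext fun d => by simpa using h d)
  have hP₀ : eval (fun p => Matrix.diagonal d p.1 p.2) P ≠ 0 := by
    have h := hP (Matrix.diagonal d) (fun i => (d i : ℂ)) (by
      rw [Matrix.diagonal_map (map_zero _), Matrix.charpoly_diagonal]
      rfl)
    intro h0
    rw [h0, map_zero] at h
    apply hd
    have h' : aeval (fun i => algebraMap ℝ ℂ (d i)) (sepPoly (Fin n)) = 0 := h.symm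
    simpa using (MvPolynomial.aeval_algebraMap_apply ℂ d (sepPoly (Fin n))).symm.trans h'
  have hA (A : Matrix (Fin n) (Fin n) ℝ) (h : eval (fun p => A p.1 p.2) P ≠ 0) :
      AssumptionA A := by
    obtain ⟨r, hr⟩ := (A.map (algebraMap ℝ ℂ)).exists_charpoly_eq_prod_X_sub_C
    have hr' : aeval r (sepPoly (Fin n)) ≠ 0 := by
      rw [← hP A r hr]
      simpa using h
    obtain ⟨hinj, hone⟩ := (aeval_sepPoly_ne_zero_iff r).1 hr'
    exact assumptionA_of_separated hr hinj hone
  exact ⟨containsDenseOpenFullMeasure_of_eval_ne_zero P _ hP₀ fun A h => (hA A h).1,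
    containsDenseOpenFullMeasure_of_eval_ne_zero P _ hP₀ hA⟩
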